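/- Let $\mathbf{k}$ be a nonzero unitary commutative ring, let $X$ and $\Omega\neq\emptyset$ be well-ordered sets, and let $(\lambda_\omega)_{\omega\in\Omega}$ be a family of elements of $\mathbf{k}$. Let $\mathfrak{M}(X,\Omega)$ be the set of $\Omega$-bracketed words in $X$: the smallest monoid of finite words (with unit the empty word $1$ and product the concatenation) that satisfies $\mathfrak{M}(X,\Omega)=M\big(X\sqcup\bigsqcup_{\omega\in\Omega}\lfloor\mathfrak{M}(X,\Omega)\rfloor_\omega\big)$, where $M(Y)$ is the free monoid on $Y$ and $\lfloor Y\rfloor_\omega=\{\lfloor y\rfloor_\omega\mid y\in Y\}$ are disjoint copies of $Y$. The breadth $|u|$ is the number of factors of $u$ in $X\sqcup\bigsqcup_\omega\lfloor\mathfrak{M}(X,\Omega)\rfloor_\omega$. The monoid algebra $\mathbf{k}\mathfrak{M}(X,\Omega)$, with the linear operators $u\mapsto\lfloor u\rfloor_\omega$, is the free $\Omega$-operated algebra on $X$. *The order.* Every word is uniquely $u=u_0\lfloor\tilde u_1\rfloor_{\alpha_1}u_1\cdots\lfloor\tilde u_r\rfloor_{\alpha_r}u_r$ with $u_i\in M(X)$,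 $\tilde u_i\in\mathfrak{M}(X,\Omega)$, $\alpha_i\in\Omega$. Put $\mathrm{br}_P(u)=r$ and let $\deg_P(u)$ be the number of all occurrences of brackets in $u$. Define the order $\leq_{\mathrm{db}}$ recursively: compare first $\deg_P$, then $\mathrm{br}_P$, then lexicographically the tuples $(\alpha_1,\tilde u_1,\dots,\alpha_r,\tilde u_r,u_0,\dots,u_r)$, where the $\alpha_i$ are compared in $\Omega$, the $\tilde u_i$ by $\leq_{\mathrm{db}}$, and the $u_i$ by the degree lexicographic order on $M(X)$ (first length, then lexicographically). *Gröbner–Shirshov bases.* A $\star$-bracketed word is a word $q\in\mathfrak{M}(X\sqcup\{\star\},\Omega)$ in which $\star$ occurs exactly once; $q|_u$ is the result of replacing $\star$ by $u$, extended linearly to $q|_s$ for $s\in\mathbf{k}\mathfrak{M}(X,\Omega)$. A monomial order is a well order $\leq$ on $\mathfrak{M}(X,\Omega)$ such that $u<v$ implies $q|_u<q|_v$ for all $\star$-bracketed words $q$. Given a monomial order, let $\bar f$ be the largest word that appears in $f\neq0$; $f$ is monic if $f\notin\mathbf{k}$ and $\bar f$ has coefficient $1$ in $f$. For a set $S$ of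 monic elements and a word $w$, an element is trivial modulo $(S,w)$ if it is a finite (possibly empty) sum $\sum_i c_iq_i|_{s_i}$ with $0\neq c_i\in\mathbf{k}$, $q_i$ a $\star$-bracketed word, $s_i\in S$ and $q_i|_{\overline{s_i}}<w$. The set $S$ is a Gröbner–Shirshov basis if for all $f,g\in S$ (including $f=g$): 1. if $u,v,w$ are words with $w=\bar fu=v\bar g$ and $\max\{|\bar f|,|\bar g|\}<|w|<|\bar f|+|\bar g|$, then $fu-vg$ is trivial modulo $(S,w)$; 2. if $q$ is a $\star$-bracketed word with $w=\bar f=q|_{\bar g}$, then $f-q|_g$ is trivial modulo $(S,w)$. **Theorem.** The order $\leq_{\mathrm{db}}$ is a monomial order on $\mathfrak{M}(X,\Omega)$, and with respect to it the set $$S=\left\{\lfloor x\rfloor_\alpha\lfloor y\rfloor_\beta-\lfloor x\lfloor y\rfloor_\beta\rfloor_\alpha-\lfloor\lfloor x\rfloor_\alpha y\rfloor_\beta-\lambda_\beta\lfloor xy\rfloor_\alpha\;\middle|\;x,y\in\mathfrak{M}(X,\Omega),\ \alpha,\beta\in\Omega\right\}$$ consists of monic elements and is a Gröbner–Shirshov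 basis in $\mathbf{k}\mathfrak{M}(X,\Omega)$. -/

import Mathlib

/-- The set `𝔐(X, Ω)` of `Ω`-bracketed words in `X`: a word is the empty word `1`, or a letter
`x ∈ X` followed by a word, or a bracketed word `⌊u⌋_ω` followed by a word. Thus a word is exactly
a finite sequence of elements of `X ⊔ ⨆_ω ⌊𝔐(X, Ω)⌋_ω`, see `BracketedWord.equivList`. -/
inductive BracketedWord (X Ω : Type*) where
  | one : BracketedWord X Ω
  | letter : X → BracketedWord X Ω → BracketedWord X Ω
  | bracket : Ω → BracketedWord X Ω → BracketedWord X Ω → BracketedWord X Ω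

namespace BracketedWord

/-- Concatenation of bracketed words. -/
def append {X Ω : Type*} : BracketedWord X Ω → BracketedWord X Ω → BracketedWord X Ω
  | one, v => v
  | letter x w, v => letter x (append w v)
  | bracket ω a w, v => bracket ω a (append w v)

theorem append_one {X Ω : Type*} (u : BracketedWord X Ω) : append u one = u := by
  induction u with
  | one => rfl
  | letter x w ih => simp [append, ih]
  | bracket ω a w _ ih => simp [append, ih]

theorem append_assoc {X Ω : Type*} (u v w : BracketedWord X Ω) :
    append (append u v) w = append u (append v w) := by
  induction u with
  | one => rfl
  | letter x u ih => simp [append, ih]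
  | bracket ω a u _ ih => simp [append, ih]

instance instMonoid {X Ω : Type*} : Monoid (BracketedWord X Ω) where
  mul := append
  one := one
  one_mul _ := rfl
  mul_one := append_one
  mul_assoc := append_assoc

/-- The word `⌊u⌋_ω`, of breadth one. -/
def brac {X Ω : Type*} (ω : Ω) (u : BracketedWord X Ω) : BracketedWord X Ω := bracket ω u one

/-- The factorization of a word into elements of `X` and bracketed words. -/
def toList {X Ω : Type*} : BracketedWord X Ω → List (X ⊕ Ω × BracketedWord X Ω)
  | one => []
  | letter x w => Sum.inl x :: toList w
  | bracket ω a w => Sum.inr (ω, a) :: toList w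

/-- The word with a given factorization. -/
def ofList {X Ω : Type*} : List (X ⊕ Ω × BracketedWord X Ω) → BracketedWord X Ω
  | [] => one
  | Sum.inl x :: l => letter x (ofList l)
  | Sum.inr (ω, a) :: l => bracket ω a (ofList l)

/-- Unique factorization: `𝔐(X, Ω) = M(X ⊔ ⨆_ω ⌊𝔐(X, Ω)⌋_ω)`. -/
def equivList (X Ω : Type*) : BracketedWord X Ω ≃ List (X ⊕ Ω × BracketedWord X Ω) where
  toFun := toList
  invFun := ofList
  left_inv u := by
    induction u with
    | one => rfl
    | letter x w ih => simp [toList, ofList, ih]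
    | bracket ω a w _ ih => simp [toList, ofList, ih]
  right_inv l := by
    induction l with
    | nil => rfl
    | cons c l ih => rcases c with x | ⟨ω, a⟩ <;> simp [toList, ofList, ih]

theorem toList_mul {X Ω : Type*} (u v : BracketedWord X Ω) :
    toList (u * v) = toList u ++ toList v := by
  change toList (append u v) = _
  induction u with
  | one => rfl
  | letter x u ih => simp [toList, append, ih]
  | bracket ω a u _ ih => simp [toList, append, ih]

/-- The breadth `|u|`: the number of factors of `u` in `X ⊔ ⨆_ω ⌊𝔐(X, Ω)⌋_ω`. -/
def breadth {X Ω : Type*} : BracketedWord X Ω → ℕ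
  | one => 0
  | letter _ w => breadth w + 1
  | bracket _ _ w => breadth w + 1

/-- `deg_P u`: the number of all occurrences of brackets in `u`, at every depth. -/
def degP {X Ω : Type*} : BracketedWord X Ω → ℕ
  | one => 0
  | letter _ w => degP w
  | bracket _ a w => degP a + degP w + 1

/-- The sequence `(α₁, 𝔲₁), …, (α_r, 𝔲_r)` in the decomposition
`u = u₀ ⌊𝔲₁⌋_{α₁} u₁ ⋯ ⌊𝔲_r⌋_{α_r} u_r` with `u₀, …, u_r ∈ M(X)`. -/
def blocks {X Ω : Type*} : BracketedWord X Ω → List (Ω × BracketedWord X Ω)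
  | one => []
  | letter _ w => blocks w
  | bracket ω a w => (ω, a) :: blocks w

/-- The sequence `u₀, …, u_r` of elements of `M(X)` in the decomposition
`u = u₀ ⌊𝔲₁⌋_{α₁} u₁ ⋯ ⌊𝔲_r⌋_{α_r} u_r`. -/
def gaps {X Ω : Type*} : BracketedWord X Ω → List (List X)
  | one => [[]]
  | letter x w => (gaps w).modifyHead (fun l => x :: l)
  | bracket _ _ w => [] :: gaps w

/-- The `P`-breadth `r` of `u = u₀ ⌊𝔲₁⌋_{α₁} u₁ ⋯ ⌊𝔲_r⌋_{α_r} u_r`. -/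
def breadthP {X Ω : Type*} (u : BracketedWord X Ω) : ℕ := (blocks u).length

/-- The strict order `u <_db v`. Compare first `deg_P`, then the `P`-breadth, then lexicographically
`(α₁, 𝔲₁, …, α_r, 𝔲_r, u₀, …, u_r)`, where `Ω` carries its given order, the words `𝔲ᵢ` are compared
by `<_db` itself, and the `uᵢ ∈ M(X)` by the degree lexicographic order `List.Shortlex`.
The third and fourth case say that the first difference of the two tuples is at some `αᵢ`,
respectively at some `𝔲ᵢ`. See `dbLT_iff` for the same definition as one recursive equation. -/
inductive DbLT {X Ω : Type*} [LinearOrder X] [LinearOrder Ω] :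
    BracketedWord X Ω → BracketedWord X Ω → Prop
  | degP {u v : BracketedWord X Ω} : degP u < degP v → DbLT u v
  | breadthP {u v : BracketedWord X Ω} :
      BracketedWord.degP u = BracketedWord.degP v → breadthP u < breadthP v → DbLT u v
  | operator {u v : BracketedWord X Ω} (p s t : List (Ω × BracketedWord X Ω)) (α β : Ω)
      (a b : BracketedWord X Ω) :
      BracketedWord.degP u = BracketedWord.degP v →
      BracketedWord.breadthP u = BracketedWord.breadthP v →
      blocks u = p ++ (α, a) :: s → blocks v = p ++ (β, b) :: t → α < β → DbLT u v
  | argument {u v : BracketedWord X Ω} (p s t : List (Ω × BracketedWord X Ω)) (α : Ω)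
      (a b : BracketedWord X Ω) :
      BracketedWord.degP u = BracketedWord.degP v →
      BracketedWord.breadthP u = BracketedWord.breadthP v →
      blocks u = p ++ (α, a) :: s → blocks v = p ++ (α, b) :: t → DbLT a b → DbLT u v
  | gaps {u v : BracketedWord X Ω} :
      BracketedWord.degP u = BracketedWord.degP v →
      blocks u = blocks v →
      List.Lex (List.Shortlex (· < ·)) (gaps u) (gaps v) → DbLT u v

theorem lex_iff_first_difference {A : Type*} {r : A → A → Prop} (l m : List A)
    (h : l.length = m.length) :
    List.Lex r l m ↔ ∃ p s t a b, l = p ++ a :: s ∧ m = p ++ b :: t ∧ r a b := by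
  constructor
  · intro hl
    induction hl with
    | nil => simp at h
    | rel hab => exact ⟨[], _, _, _, _, rfl, rfl, hab⟩
    | @cons c l m _ ih =>
      obtain ⟨p, s, t, a, b, rfl, rfl, hr⟩ := ih (by simpa using h)
      exact ⟨c :: p, s, t, a, b, rfl, rfl, hr⟩
  · rintro ⟨p, s, t, a, b, rfl, rfl, hr⟩
    clear h
    induction p with
    | nil => exact List.Lex.rel hr
    | cons c p ih => exact List.Lex.cons ih

/-- The recursive characterization of `<_db`. -/
theorem dbLT_iff {X Ω : Type*} [LinearOrder X] [LinearOrder Ω] (u v : BracketedWord X Ω) :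
    DbLT u v ↔
      degP u < degP v ∨
      (degP u = degP v ∧ breadthP u < breadthP v) ∨
      (degP u = degP v ∧ breadthP u = breadthP v ∧
        (List.Lex (Prod.Lex (· < ·) DbLT) (blocks u) (blocks v) ∨
          (blocks u = blocks v ∧
            List.Lex (List.Shortlex (· < ·)) (gaps u) (gaps v)))) := by
  constructor
  · intro h
    cases h with
    | degP h => exact Or.inl h
    | breadthP h₁ h₂ => exact Or.inr (Or.inl ⟨h₁, h₂⟩)
    | operator p s t α β a b h₁ h₂ h₃ h₄ h₅ =>
      refine Or.inr (Or.inr ⟨h₁, h₂, Or.inl ?_⟩)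
      exact (lex_iff_first_difference _ _ h₂).2 ⟨p, s, t, _, _, h₃, h₄, Prod.Lex.left _ _ h₅⟩
    | argument p s t α a b h₁ h₂ h₃ h₄ h₅ =>
      refine Or.inr (Or.inr ⟨h₁, h₂, Or.inl ?_⟩)
      exact (lex_iff_first_difference _ _ h₂).2 ⟨p, s, t, _, _, h₃, h₄, Prod.Lex.right _ h₅⟩
    | gaps h₁ h₂ h₃ =>
      exact Or.inr (Or.inr ⟨h₁, by simp [breadthP, h₂], Or.inr ⟨h₂, h₃⟩⟩)
  · rintro (h | ⟨h₁, h₂⟩ | ⟨h₁, h₂, h | ⟨h₃, h₄⟩⟩)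
    · exact DbLT.degP h
    · exact DbLT.breadthP h₁ h₂
    · obtain ⟨p, s, t, ⟨α, a⟩, ⟨β, b⟩, h₃, h₄, h₅⟩ := (lex_iff_first_difference _ _ h₂).1 h
      rcases Prod.lex_def.1 h₅ with h₅ | ⟨h₅, h₆⟩
      · exact DbLT.operator p s t α β a b h₁ h₂ h₃ h₄ h₅
      · obtain rfl : α = β := h₅
        exact DbLT.argument p s t α a b h₁ h₂ h₃ h₄ h₆
    · exact DbLT.gaps h₁ h₃ h₄

/-- The order `u ≤_db v`. -/
def DbLE {X Ω : Type*} [LinearOrder X] [LinearOrder Ω] (u v : BracketedWord X Ω) : Prop :=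
  u = v ∨ DbLT u v

/-- The number of occurrences of `⋆` (represented by `none`) in a word on `X ⊔ {⋆}`. -/
def starCount {X Ω : Type*} : BracketedWord (Option X) Ω → ℕ
  | one => 0
  | letter none w => starCount w + 1
  | letter (some _) w => starCount w
  | bracket _ a w => starCount a + starCount w

/-- Substitution of the word `u` for every occurrence of `⋆`. -/
def substStar {X Ω : Type*} (u : BracketedWord X Ω) : BracketedWord (Option X) Ω → BracketedWord X Ω
  | one => one
  | letter none w => u * substStar u w
  | letter (some x) w => letter x (substStar u w)
  | bracket ω a w => bracket ω (substStar u a) (substStar u w)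

end BracketedWord

/-- `⋆`-bracketed words: bracketed words on `X ⊔ {⋆}` with exactly one occurrence of `⋆`. -/
def StarWord (X Ω : Type*) : Type _ :=
  {q : BracketedWord (Option X) Ω // q.starCount = 1}

/-- The word `q|_u`. -/
def StarWord.plug {X Ω : Type*} (q : StarWord X Ω) (u : BracketedWord X Ω) : BracketedWord X Ω :=
  BracketedWord.substStar u q.1

/-- Bracketed polynomials: the `k`-algebra `k𝔐(X, Ω)`. -/
abbrev BracketedPoly (k X Ω : Type*) [CommRing k] : Type _ :=
  MonoidAlgebra k (BracketedWord X Ω)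

/-- A bracketed word as a bracketed polynomial. -/
noncomputable def BracketedWord.toPoly (k : Type*) {X Ω : Type*} [CommRing k]
    (u : BracketedWord X Ω) : BracketedPoly k X Ω :=
  MonoidAlgebra.single u 1

/-- The polynomial `q|_s = ∑ cᵢ q|_{uᵢ}` for `s = ∑ cᵢ uᵢ`. -/
noncomputable def StarWord.plugPoly {k X Ω : Type*} [CommRing k] (q : StarWord X Ω)
    (s : BracketedPoly k X Ω) : BracketedPoly k X Ω :=
  MonoidAlgebra.mapDomain q.plug s

/-- The strict relation `u < v`, that is, `u ≤ v` and `u ≠ v`. -/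
def StrictOf {A : Type*} (le : A → A → Prop) (u v : A) : Prop := le u v ∧ u ≠ v

/-- Monomial orders on `𝔐(X, Ω)`: well orders `≤` such that `u < v` implies `q|_u < q|_v`. -/
structure IsMonomialOrder {X Ω : Type*}
    (le : BracketedWord X Ω → BracketedWord X Ω → Prop) : Prop where
  refl : ∀ u, le u u
  trans : ∀ u v w, le u v → le v w → le u w
  antisymm : ∀ u v, le u v → le v u → u = v
  total : ∀ u v, le u v ∨ le v u
  wf : WellFounded (StrictOf le)
  plug_lt : ∀ (q : StarWord X Ω) (u v : BracketedWord X Ω),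
    StrictOf le u v → StrictOf le (q.plug u) (q.plug v)

/-- `m` is the leading monomial of `f`: the largest word that appears in `f`. -/
def IsLeadingWord {k X Ω : Type*} [CommRing k]
    (le : BracketedWord X Ω → BracketedWord X Ω → Prop)
    (f : BracketedPoly k X Ω) (m : BracketedWord X Ω) : Prop :=
  f.coeff m ≠ 0 ∧ ∀ u, f.coeff u ≠ 0 → le u m

/-- `f` is monic: `f ∉ k`, and its leading coefficient is `1`. -/
def IsMonicPoly {k X Ω : Type*} [CommRing k]
    (le : BracketedWord X Ω → BracketedWord X Ω → Prop) (f : BracketedPoly k X Ω) : Prop :=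
  f ∉ Set.range (algebraMap k (BracketedPoly k X Ω)) ∧
    ∃ m, IsLeadingWord le f m ∧ f.coeff m = 1

/-- `h` is trivial modulo `(S, w)`: it is a linear combination `∑ cᵢ qᵢ|_{sᵢ}` with `cᵢ ≠ 0`,
`sᵢ ∈ S` and `qᵢ|_{s̄ᵢ} < w`, where `s̄ᵢ` is the leading monomial of `sᵢ`. -/
def IsTrivialMod {k X Ω : Type*} [CommRing k]
    (le : BracketedWord X Ω → BracketedWord X Ω → Prop)
    (S : Set (BracketedPoly k X Ω)) (w : BracketedWord X Ω) (h : BracketedPoly k X Ω) : Prop :=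
  ∃ (n : ℕ) (c : Fin n → k) (q : Fin n → StarWord X Ω) (s : Fin n → BracketedPoly k X Ω),
    (∀ i, c i ≠ 0 ∧ s i ∈ S ∧
      ∃ m, IsLeadingWord le (s i) m ∧ StrictOf le ((q i).plug m) w) ∧
    h = ∑ i, c i • (q i).plugPoly (s i)

/-- `S` is a Gröbner-Shirshov basis with respect to `≤`: the order is a monomial order, `S` is
monic, and all intersection and including compositions of elements of `S` are trivial. -/
structure IsGroebnerShirshovBasis {k X Ω : Type*} [CommRing k]
    (le : BracketedWord X Ω → BracketedWord X Ω → Prop)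
    (S : Set (BracketedPoly k X Ω)) : Prop where
  monomialOrder : IsMonomialOrder le
  monic : ∀ f ∈ S, IsMonicPoly le f
  intersection : ∀ f ∈ S, ∀ g ∈ S, ∀ mf mg : BracketedWord X Ω,
    IsLeadingWord le f mf → IsLeadingWord le g mg →
    ∀ u v w : BracketedWord X Ω, w = mf * u → w = v * mg →
      max mf.breadth mg.breadth < w.breadth → w.breadth < mf.breadth + mg.breadth →
      IsTrivialMod le S w (f * u.toPoly k - v.toPoly k * g)
  including : ∀ f ∈ S, ∀ g ∈ S, ∀ mf mg : BracketedWord X Ω,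
    IsLeadingWord le f mf → IsLeadingWord le g mg →
    ∀ (q : StarWord X Ω) (w : BracketedWord X Ω), w = mf → w = q.plug mg →
      IsTrivialMod le S w (f - q.plugPoly g)

/-- The matching Rota-Baxter relation
`⌊x⌋_α ⌊y⌋_β - ⌊x ⌊y⌋_β⌋_α - ⌊⌊x⌋_α y⌋_β - λ_β ⌊x y⌋_α`. -/
noncomputable def matchingRelation {k X Ω : Type*} [CommRing k] (wt : Ω → k) (α β : Ω)
    (x y : BracketedWord X Ω) : BracketedPoly k X Ω :=
  (x.brac α * y.brac β).toPoly k - ((x * y.brac β).brac α).toPoly k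
    - ((x.brac α * y).brac β).toPoly k - wt β • ((x * y).brac α).toPoly k

/-- The set `S` of all matching Rota-Baxter relations of weight `(λ_ω)`. -/
def matchingRelations {k : Type*} (X : Type*) {Ω : Type*} [CommRing k] (wt : Ω → k) :
    Set (BracketedPoly k X Ω) :=
  {f | ∃ (α β : Ω) (x y : BracketedWord X Ω), f = matchingRelation wt α β x y}

namespace BracketedWord

/-! Order. The recursion in `DbLT` only descends to arguments of brackets, which have smaller deg_P.
Induction on a bound for deg_P therefore gives well-foundedness: at each stage the order maps into a
lexicographic product of well-founded orders (`wellFounded_dbLT_degP_lt`). Totality uses the same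
descent, together with the fact that blocks and gaps determine a word. A ⋆-context is built from
brackets and from products on either side. The delicate case is right multiplication, where the last
gap of the left factor fuses with the first gap of the right one (`DbLT.mul_right`).

Compositions. In a relation, ⌊x⌋_α⌊y⌋_β has P-breadth 2, while the other three words are single
brackets with no larger deg_P; so it is the leading word. An intersection has breadth 3 and comes
from ⌊x⌋_α⌊y⌋_β⌊z⌋_γ. Reducing the two sides fully gives the same result, which amounts to an
explicit identity (`intersection_mem_trivialSpan`). In an inclusion, the inner leading word is
either the whole word, and then f = g, or it lies inside x or y. That last case follows from the
bilinearity of the relation in x and y (`including_left_mem_trivialSpan`,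
`including_right_mem_trivialSpan`). -/

theorem modifyLast_cons {A : Type*} (f : A → A) (a : A) {l : List A} (hl : l ≠ []) :
    (a :: l).modifyLast f = a :: l.modifyLast f :=
  List.modifyLast_append_of_right_ne_nil f [a] l hl

/-! ### Invariants of a word: degree, breadths, blocks and gaps -/

section Basic

variable {X Ω : Type*}

@[simp] theorem one_eq : (one : BracketedWord X Ω) = 1 := rfl

@[simp] theorem letter_mul (x : X) (u v : BracketedWord X Ω) :
    letter x u * v = letter x (u * v) := rfl

@[simp] theorem bracket_mul (ω : Ω) (a u v : BracketedWord X Ω) :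
    bracket ω a u * v = bracket ω a (u * v) := rfl

theorem letter_eq_mul (x : X) (u : BracketedWord X Ω) : letter x u = letter x 1 * u := rfl

theorem bracket_eq_mul (ω : Ω) (a u : BracketedWord X Ω) : bracket ω a u = brac ω a * u := rfl

@[simp] theorem degP_one : degP (1 : BracketedWord X Ω) = 0 := rfl

@[simp] theorem breadth_one : breadth (1 : BracketedWord X Ω) = 0 := rfl

@[simp] theorem blocks_one : blocks (1 : BracketedWord X Ω) = [] := rfl

@[simp] theorem gaps_one : gaps (1 : BracketedWord X Ω) = [[]] := rfl

@[simp] theorem degP_mul (u v : BracketedWord X Ω) : degP (u * v) = degP u + degP v := by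
  induction u with
  | one => simp
  | letter x u ih => simp [degP, ih]
  | bracket ω a u _ ih => simp [degP, ih]; omega

@[simp] theorem breadth_mul (u v : BracketedWord X Ω) :
    breadth (u * v) = breadth u + breadth v := by
  induction u with
  | one => simp
  | letter x u ih => simp [breadth, ih]; omega
  | bracket ω a u _ ih => simp [breadth, ih]; omega

@[simp] theorem blocks_mul (u v : BracketedWord X Ω) : blocks (u * v) = blocks u ++ blocks v := by
  induction u with
  | one => simp
  | letter x u ih => simp [blocks, ih]
  | bracket ω a u _ ih => simp [blocks, ih]

@[simp] theorem breadthP_mul (u v : BracketedWord X Ω) :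
    breadthP (u * v) = breadthP u + breadthP v := by
  simp [breadthP]

@[simp] theorem degP_brac (ω : Ω) (u : BracketedWord X Ω) : degP (brac ω u) = degP u + 1 := by
  simp [brac, degP]

@[simp] theorem breadthP_brac (ω : Ω) (u : BracketedWord X Ω) : breadthP (brac ω u) = 1 := by
  simp [brac, breadthP, blocks]

@[simp] theorem breadth_brac (ω : Ω) (u : BracketedWord X Ω) : breadth (brac ω u) = 1 := by
  simp [brac, breadth]

theorem breadth_eq_zero {u : BracketedWord X Ω} (h : breadth u = 0) : u = 1 := by
  cases u with
  | one => rfl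
  | letter x u => simp [breadth] at h
  | bracket ω a u => simp [breadth] at h

theorem gaps_ne_nil (u : BracketedWord X Ω) : gaps u ≠ [] := by
  induction u with
  | one => simp [gaps]
  | letter x u ih => simpa [gaps] using ih
  | bracket ω a u _ ih => simp [gaps]

theorem length_gaps (u : BracketedWord X Ω) : (gaps u).length = breadthP u + 1 := by
  induction u with
  | one => simp [gaps, breadthP, blocks]
  | letter x u ih => simpa [gaps, breadthP, blocks] using ih
  | bracket ω a u _ ih => simpa [gaps, breadthP, blocks] using ih

/-- A nonempty first gap signals a leading letter; an empty one signals a bracket or the end of the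
word, and `blocks` tells these apart. So the word can be rebuilt factor by factor. -/
theorem eq_of_blocks_eq_of_gaps_eq {u v : BracketedWord X Ω} (hb : blocks u = blocks v)
    (hg : gaps u = gaps v) : u = v := by
  induction u generalizing v with
  | one =>
    cases v with
    | one => rfl
    | letter y v =>
      obtain ⟨g, gs, h⟩ := List.exists_cons_of_ne_nil (gaps_ne_nil v)
      simp [gaps, h] at hg
    | bracket ω b v => simp [blocks] at hb
  | letter x u ih =>
    obtain ⟨g, gs, h⟩ := List.exists_cons_of_ne_nil (gaps_ne_nil u)
    cases v with
    | one => simp [gaps, h] at hg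
    | letter y v =>
      obtain ⟨g', gs', h'⟩ := List.exists_cons_of_ne_nil (gaps_ne_nil v)
      simp only [gaps, h, h', List.modifyHead_cons, List.cons.injEq] at hg
      obtain ⟨⟨rfl, rfl⟩, rfl⟩ := hg
      have hg : gaps u = gaps v := h.trans h'.symm
      have hb : blocks u = blocks v := hb
      rw [ih hb hg]
    | bracket ω b v => simp [gaps, h] at hg
  | bracket ω a u _ ih =>
    cases v with
    | one => simp [blocks] at hb
    | letter y v =>
      obtain ⟨g, gs, h⟩ := List.exists_cons_of_ne_nil (gaps_ne_nil v)
      simp [gaps, h] at hg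
    | bracket ω' b v =>
      simp only [blocks, List.cons.injEq, Prod.mk.injEq] at hb
      obtain ⟨⟨rfl, rfl⟩, hb⟩ := hb
      rw [ih hb (by simpa [gaps] using hg)]

theorem degP_lt_of_mem_blocks {u a : BracketedWord X Ω} {ω : Ω} (h : (ω, a) ∈ blocks u) :
    degP a < degP u := by
  induction u with
  | one => simp at h
  | letter x u ih => exact ih h
  | bracket ω' b u _ ih =>
    simp only [blocks, List.mem_cons, Prod.mk.injEq] at h
    simp only [degP]
    rcases h with ⟨_, rfl⟩ | h
    · omega
    · have := ih h; omega

theorem gaps_mul_letter (u : BracketedWord X Ω) (x : X) :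
    gaps (u * letter x 1) = (gaps u).modifyLast (· ++ [x]) := by
  induction u with
  | one => simp [gaps, List.modifyLast, List.modifyLast.go]
  | letter y u ih =>
    rw [letter_mul, gaps, ih, gaps]
    obtain ⟨g, gs, h⟩ := List.exists_cons_of_ne_nil (gaps_ne_nil u)
    rw [h]
    cases gs with
    | nil => simp [List.modifyLast, List.modifyLast.go]
    | cons g' gs => simp [modifyLast_cons]
  | bracket ω a u _ ih => rw [bracket_mul, gaps, ih, gaps, modifyLast_cons _ _ (gaps_ne_nil u)]

theorem gaps_mul_brac (u : BracketedWord X Ω) (ω : Ω) (a : BracketedWord X Ω) :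
    gaps (u * brac ω a) = gaps u ++ [[]] := by
  induction u with
  | one => simp [brac, gaps]
  | letter y u ih =>
    obtain ⟨g, gs, h⟩ := List.exists_cons_of_ne_nil (gaps_ne_nil u)
    simp [gaps, ih, h]
  | bracket ω a u _ ih => simp [gaps, ih]

end Basic

/-! ### Lexicographic comparison of lists -/

section Lists

variable {A : Type*}

theorem exists_first_difference {l m : List A} (h : l.length = m.length) (hne : l ≠ m) :
    ∃ p s t a b, l = p ++ a :: s ∧ m = p ++ b :: t ∧ a ≠ b := by
  induction l generalizing m with
  | nil => cases m <;> simp_all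
  | cons a l ih =>
    cases m with
    | nil => simp at h
    | cons b m =>
      by_cases hab : a = b
      · subst hab
        obtain ⟨p, s, t, c, d, rfl, rfl, hcd⟩ := ih (m := m) (by simpa using h) (by simpa using hne)
        exact ⟨a :: p, s, t, c, d, rfl, rfl, hcd⟩
      · exact ⟨[], l, m, a, b, rfl, rfl, hab⟩

/-- Equal lengths put the first difference inside both lists. A comparison won by a proper prefix
need not survive appending. -/
theorem lex_append_of_length_eq {r : A → A → Prop} {l m : List A} (h : List.Lex r l m)
    (hl : l.length = m.length) (n : List A) : List.Lex r (l ++ n) (m ++ n) := by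
  obtain ⟨p, s, t, a, b, rfl, rfl, hr⟩ := (lex_iff_first_difference _ _ hl).1 h
  exact (lex_iff_first_difference _ _ (by simpa using hl)).2
    ⟨p, s ++ n, t ++ n, a, b, by simp, by simp, hr⟩

theorem shortlex_append_singleton {r : A → A → Prop} {l m : List A} (h : List.Shortlex r l m)
    (a : A) : List.Shortlex r (l ++ [a]) (m ++ [a]) := by
  rcases List.shortlex_def.1 h with h | ⟨h, h'⟩
  · exact .of_length_lt (by simpa using h)
  · exact .of_lex (by simpa using h) (lex_append_of_length_eq h' h _)

theorem shortlex_cons {r : A → A → Prop} {l m : List A} (h : List.Shortlex r l m)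
    (a : A) : List.Shortlex r (a :: l) (a :: m) := by
  rcases List.shortlex_def.1 h with h | ⟨h, h'⟩
  · exact .of_length_lt (by simpa using h)
  · exact .of_lex (by simpa using h) (.cons h')

theorem lex_modifyHead {r : A → A → Prop} {f : A → A} (hf : ∀ a b, r a b → r (f a) (f b))
    {l m : List A} (h : List.Lex r l m) :
    List.Lex r (l.modifyHead f) (m.modifyHead f) := by
  cases h with
  | nil => exact .nil
  | cons h => exact .cons h
  | rel h => exact .rel (hf _ _ h)

theorem lex_modifyLast {r : A → A → Prop} {f : A → A} (hf : ∀ a b, r a b → r (f a) (f b))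
    {l m : List A} (h : List.Lex r l m) (hl : l.length = m.length) :
    List.Lex r (l.modifyLast f) (m.modifyLast f) := by
  obtain ⟨p, s, t, a, b, rfl, rfl, hr⟩ := (lex_iff_first_difference _ _ hl).1 h
  rw [List.modifyLast_append_of_right_ne_nil _ _ _ (by simp),
    List.modifyLast_append_of_right_ne_nil _ _ _ (by simp)]
  refine List.Lex.append_left _ ?_ p
  rcases s with _ | ⟨c, s⟩ <;> rcases t with _ | ⟨d, t⟩
  · exact .rel (hf _ _ hr)
  · simp at hl
  · simp at hl
  · rw [modifyLast_cons _ a (List.cons_ne_nil c s), modifyLast_cons _ b (List.cons_ne_nil d t)]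
    exact .rel hr

end Lists

/-! ### Well-foundedness, totality and compatibility with products -/

section Order

variable {X Ω : Type*} [LinearOrder X] [LinearOrder Ω]

theorem DbLT.degP_le {u v : BracketedWord X Ω} (h : DbLT u v) :
    BracketedWord.degP u ≤ BracketedWord.degP v := by
  cases h with
  | degP h => exact h.le
  | breadthP h => exact h.le
  | operator _ _ _ _ _ _ _ h => exact h.le
  | argument _ _ _ _ _ _ h => exact h.le
  | gaps h => exact h.le

/-- The bound `n` breaks the self-reference of `DbLT`: words compared under bound `n + 1` have
bracket arguments under bound `n`. -/
theorem wellFounded_dbLT_degP_lt [WellFoundedLT X] [WellFoundedLT Ω] (n : ℕ) :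
    WellFounded (fun u v : BracketedWord X Ω => DbLT u v ∧ degP v < n) := by
  induction n with
  | zero => exact ⟨fun v => ⟨_, fun u h => absurd h.2 (Nat.not_lt_zero _)⟩⟩
  | succ n ih =>
    have hX : WellFounded ((· < ·) : X → X → Prop) := wellFounded_lt
    have hΩ : WellFounded ((· < ·) : Ω → Ω → Prop) := wellFounded_lt
    have hN : WellFounded ((· < ·) : ℕ → ℕ → Prop) := wellFounded_lt
    -- `Shortlex` replaces `Lex`, which is not well-founded on lists of unbounded length. Its
    -- comparison of lengths of `blocks` also absorbs the comparison of P-breadths.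
    have key := InvImage.wf
      (fun u : BracketedWord X Ω => (degP u, (blocks u, gaps u)))
      (hN.prod_lex ((List.Shortlex.wf (hΩ.prod_lex ih)).prod_lex
        (List.Shortlex.wf (List.Shortlex.wf hX))))
    refine Subrelation.wf (fun {u v} h => ?_) key
    obtain ⟨h, hn⟩ := h
    cases h with
    | degP h => exact .left _ _ h
    | breadthP h₁ h₂ =>
      refine Prod.lex_def.2 (.inr ⟨h₁, .left _ _ (.of_length_lt h₂)⟩)
    | operator p s t α β a b h₁ h₂ h₃ h₄ h₅ =>
      refine Prod.lex_def.2 (.inr ⟨h₁, .left _ _ (.of_lex h₂ ?_)⟩)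
      exact (lex_iff_first_difference _ _ h₂).2 ⟨p, s, t, _, _, h₃, h₄, .left _ _ h₅⟩
    | argument p s t α a b h₁ h₂ h₃ h₄ h₅ =>
      refine Prod.lex_def.2 (.inr ⟨h₁, .left _ _ (.of_lex h₂ ?_)⟩)
      refine (lex_iff_first_difference _ _ h₂).2 ⟨p, s, t, _, _, h₃, h₄, .right _ ⟨h₅, ?_⟩⟩
      have : degP b < degP v := degP_lt_of_mem_blocks (ω := α) (by simp [h₄])
      omega
    | gaps h₁ h₂ h₃ =>
      refine Prod.lex_def.2 (.inr ⟨h₁, Prod.lex_def.2 (.inr ⟨h₂, .of_lex ?_ h₃⟩)⟩)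
      simp [length_gaps, breadthP, h₂]

/-- Going down in `DbLT` never raises deg_P, so everything below `u` stays in the relation bounded
by deg_P u + 1. -/
theorem wellFounded_dbLT [WellFoundedLT X] [WellFoundedLT Ω] :
    WellFounded (DbLT : BracketedWord X Ω → BracketedWord X Ω → Prop) := by
  have aux (n : ℕ) (u : BracketedWord X Ω) : degP u < n → Acc DbLT u := by
    induction (wellFounded_dbLT_degP_lt (X := X) (Ω := Ω) n).apply u with
    | intro u _ ih =>
      exact fun hu => ⟨_, fun v hv => ih v ⟨hv, hu⟩ (hv.degP_le.trans_lt hu)⟩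
  exact ⟨fun u => aux _ u (Nat.lt_succ_self _)⟩

theorem dbLT_trichotomous (u v : BracketedWord X Ω) : DbLT u v ∨ u = v ∨ DbLT v u := by
  induction hn : degP u using Nat.strong_induction_on generalizing u v with
  | _ n ih =>
    subst hn
    rcases lt_trichotomy (degP u) (degP v) with h₁ | h₁ | h₁
    · exact .inl (.degP h₁)
    swap
    · exact .inr (.inr (.degP h₁))
    rcases lt_trichotomy (breadthP u) (breadthP v) with h₂ | h₂ | h₂
    · exact .inl (.breadthP h₁ h₂)
    swap
    · exact .inr (.inr (.breadthP h₁.symm h₂))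
    by_cases hb : blocks u = blocks v
    · have hlen : (gaps u).length = (gaps v).length := by simp [length_gaps, h₂]
      by_cases hg : gaps u = gaps v
      · exact .inr (.inl (eq_of_blocks_eq_of_gaps_eq hb hg))
      obtain ⟨p, s, t, a, b, ha, hb', hne⟩ := exists_first_difference hlen hg
      rcases trichotomous_of (List.Shortlex ((· < ·) : X → X → Prop)) a b with h | h | h
      · exact .inl (.gaps h₁ hb
          ((lex_iff_first_difference _ _ hlen).2 ⟨p, s, t, a, b, ha, hb', h⟩))
      · exact absurd h hne
      · exact .inr (.inr (.gaps h₁.symm hb.symm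
          ((lex_iff_first_difference _ _ hlen.symm).2 ⟨p, t, s, b, a, hb', ha, h⟩)))
    · obtain ⟨p, s, t, ⟨α, a⟩, ⟨β, b⟩, ha, hb', hne⟩ := exists_first_difference h₂ hb
      rcases lt_trichotomy α β with h | rfl | h
      · exact .inl (.operator p s t α β a b h₁ h₂ ha hb' h)
      · rcases ih (degP a) (degP_lt_of_mem_blocks (ω := α) (by simp [ha])) a b rfl with h | rfl | h
        · exact .inl (.argument p s t α a b h₁ h₂ ha hb' h)
        · exact absurd rfl hne
        · exact .inr (.inr (.argument p t s α b a h₁.symm h₂.symm hb' ha h))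
      · exact .inr (.inr (.operator p t s β α b a h₁.symm h₂.symm hb' ha h))

theorem DbLT.letter {u v : BracketedWord X Ω} (h : DbLT u v) (x : X) :
    DbLT (letter x u) (letter x v) := by
  cases h with
  | degP h => exact .degP h
  | breadthP h₁ h₂ => exact .breadthP h₁ h₂
  | operator p s t α β a b h₁ h₂ h₃ h₄ h₅ => exact .operator p s t α β a b h₁ h₂ h₃ h₄ h₅
  | argument p s t α a b h₁ h₂ h₃ h₄ h₅ => exact .argument p s t α a b h₁ h₂ h₃ h₄ h₅
  | gaps h₁ h₂ h₃ =>
    exact .gaps h₁ h₂ (lex_modifyHead (fun _ _ h => shortlex_cons h x) h₃)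

theorem DbLT.bracket {u v : BracketedWord X Ω} (h : DbLT u v) (ω : Ω) (c : BracketedWord X Ω) :
    DbLT (bracket ω c u) (bracket ω c v) := by
  cases h with
  | degP h => exact .degP (by simpa [BracketedWord.degP] using h)
  | breadthP h₁ h₂ =>
    exact .breadthP (by simp [BracketedWord.degP, h₁])
      (by simpa [BracketedWord.breadthP, blocks] using h₂)
  | operator p s t α β a b h₁ h₂ h₃ h₄ h₅ =>
    exact .operator ((ω, c) :: p) s t α β a b (by simp [BracketedWord.degP, h₁])
      (by simpa [BracketedWord.breadthP, blocks] using h₂) (by simp [blocks, h₃])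
      (by simp [blocks, h₄]) h₅
  | argument p s t α a b h₁ h₂ h₃ h₄ h₅ =>
    exact .argument ((ω, c) :: p) s t α a b (by simp [BracketedWord.degP, h₁])
      (by simpa [BracketedWord.breadthP, blocks] using h₂) (by simp [blocks, h₃])
      (by simp [blocks, h₄]) h₅
  | gaps h₁ h₂ h₃ =>
    exact .gaps (by simp [BracketedWord.degP, h₁]) (by simp [blocks, h₂]) (.cons h₃)

theorem DbLT.mul_left {u v : BracketedWord X Ω} (h : DbLT u v) (w : BracketedWord X Ω) :
    DbLT (w * u) (w * v) := by
  induction w with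
  | one => exact h
  | letter x w ih => exact ih.letter x
  | bracket ω a w _ ih => exact ih.bracket ω a

/-- Degree, P-breadth and blocks are additive under products, so their comparisons persist; only the
gaps require an argument depending on `w`. -/
theorem DbLT.mul_right_of_gaps {u v w : BracketedWord X Ω} (h : DbLT u v)
    (hw : List.Lex (List.Shortlex (· < ·)) (BracketedWord.gaps u) (BracketedWord.gaps v) →
      (BracketedWord.gaps u).length = (BracketedWord.gaps v).length →
      List.Lex (List.Shortlex (· < ·)) (BracketedWord.gaps (u * w)) (BracketedWord.gaps (v * w))) :
    DbLT (u * w) (v * w) := by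
  cases h with
  | degP h => exact .degP (by simpa using h)
  | breadthP h₁ h₂ => exact .breadthP (by simp [h₁]) (by simpa using h₂)
  | operator p s t α β a b h₁ h₂ h₃ h₄ h₅ =>
    exact .operator p (s ++ blocks w) (t ++ blocks w) α β a b (by simp [h₁]) (by simp [h₂])
      (by simp [h₃]) (by simp [h₄]) h₅
  | argument p s t α a b h₁ h₂ h₃ h₄ h₅ =>
    exact .argument p (s ++ blocks w) (t ++ blocks w) α a b (by simp [h₁]) (by simp [h₂])
      (by simp [h₃]) (by simp [h₄]) h₅
  | gaps h₁ h₂ h₃ =>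
    exact .gaps (by simp [h₁]) (by simp [h₂])
      (hw h₃ (by simp [length_gaps, BracketedWord.breadthP, h₂]))

/-- To control the fusion of gaps, `w` is attached one factor at a time: a letter extends the last
gap, a bracket opens a new empty one. -/
theorem DbLT.mul_right {u v : BracketedWord X Ω} (h : DbLT u v) (w : BracketedWord X Ω) :
    DbLT (u * w) (v * w) := by
  induction w generalizing u v with
  | one => simpa using h
  | letter x w ih =>
    rw [letter_eq_mul, ← mul_assoc, ← mul_assoc]
    refine ih (h.mul_right_of_gaps fun h' hl => ?_)
    rw [gaps_mul_letter, gaps_mul_letter]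
    exact lex_modifyLast (fun _ _ h => shortlex_append_singleton h x) h' hl
  | bracket ω a w _ ih =>
    rw [bracket_eq_mul, ← mul_assoc, ← mul_assoc]
    refine ih (h.mul_right_of_gaps fun h' hl => ?_)
    rw [gaps_mul_brac, gaps_mul_brac]
    exact lex_append_of_length_eq h' hl _

theorem DbLT.brac {u v : BracketedWord X Ω} (h : DbLT u v) (ω : Ω) :
    DbLT (brac ω u) (brac ω v) := by
  rcases h.degP_le.lt_or_eq with h' | h'
  · exact .degP (by simpa using h')
  · exact .argument [] [] [] ω u v (by simpa using h') (by simp) rfl rfl h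

variable [WellFoundedLT X] [WellFoundedLT Ω]

theorem DbLT.asymm {u v : BracketedWord X Ω} (h : DbLT u v) : ¬ DbLT v u :=
  wellFounded_dbLT.asymmetric _ _ h

theorem DbLT.ne {u v : BracketedWord X Ω} (h : DbLT u v) : u ≠ v := by
  rintro rfl
  exact h.asymm h

theorem DbLT.trans {u v w : BracketedWord X Ω} (h : DbLT u v) (h' : DbLT v w) : DbLT u w := by
  rcases dbLT_trichotomous u w with h'' | rfl | h''
  · exact h''
  · exact absurd h' h.asymm
  · exact (wellFounded_dbLT.asymmetric₃ _ _ _ h' h'' h).elim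

theorem strictOf_dbLE_iff {u v : BracketedWord X Ω} : StrictOf DbLE u v ↔ DbLT u v :=
  ⟨fun h => h.1.resolve_left h.2, fun h => ⟨.inr h, h.ne⟩⟩

end Order

end BracketedWord

/-! ### Substitution for ⋆ and the monomial order -/

namespace BracketedWord

variable {X Ω : Type*}

@[simp] theorem starCount_mul (p q : BracketedWord (Option X) Ω) :
    starCount (p * q) = starCount p + starCount q := by
  induction p with
  | one => exact (Nat.zero_add _).symm
  | letter x p ih => cases x <;> simp [starCount, ih]; omega
  | bracket ω a p _ ih => simp [starCount, ih]; omega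

@[simp] theorem substStar_mul (u : BracketedWord X Ω) (p q : BracketedWord (Option X) Ω) :
    substStar u (p * q) = substStar u p * substStar u q := by
  induction p with
  | one => rfl
  | letter x p ih => cases x <;> simp [substStar, ih, mul_assoc]
  | bracket ω a p _ ih => simp [substStar, ih]

theorem substStar_eq_of_starCount_eq_zero (u v : BracketedWord X Ω)
    {q : BracketedWord (Option X) Ω} (hq : starCount q = 0) : substStar u q = substStar v q := by
  induction q with
  | one => rfl
  | letter x q ih =>
    cases x with
    | none => simp [starCount] at hq
    | some x => simp [substStar, ih hq]
  | bracket ω a q iha ih =>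
    simp only [starCount, Nat.add_eq_zero_iff] at hq
    simp [substStar, iha hq.1, ih hq.2]

/-- The inclusion `𝔐(X, Ω) ⊆ 𝔐(X ⊔ {⋆}, Ω)`. -/
def withStar : BracketedWord X Ω → BracketedWord (Option X) Ω
  | one => one
  | letter x w => letter (some x) (withStar w)
  | bracket ω a w => bracket ω (withStar a) (withStar w)

@[simp] theorem starCount_withStar (u : BracketedWord X Ω) : starCount (withStar u) = 0 := by
  induction u with
  | one => rfl
  | letter x u ih => exact ih
  | bracket ω a u iha ih => simp [withStar, starCount, iha, ih]

@[simp] theorem substStar_withStar (u v : BracketedWord X Ω) : substStar v (withStar u) = u := by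
  induction u with
  | one => rfl
  | letter x u ih => simp [withStar, substStar, ih]
  | bracket ω a u iha ih => simp [withStar, substStar, iha, ih]

theorem DbLT.substStar [LinearOrder X] [LinearOrder Ω] {u v : BracketedWord X Ω} (h : DbLT u v)
    {q : BracketedWord (Option X) Ω} (hq : starCount q = 1) :
    DbLT (substStar u q) (substStar v q) := by
  induction q with
  | one => simp [starCount] at hq
  | letter x q ih =>
    cases x with
    | none =>
      simp only [starCount, Nat.add_eq_right] at hq
      rw [BracketedWord.substStar, BracketedWord.substStar, substStar_eq_of_starCount_eq_zero u v hq]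
      exact h.mul_right _
    | some x => exact (ih hq).letter x
  | bracket ω a q iha ih =>
    rw [BracketedWord.substStar, BracketedWord.substStar]
    simp only [starCount, Nat.add_eq_one_iff] at hq
    rcases hq with ⟨ha, hq⟩ | ⟨ha, hq⟩
    · rw [substStar_eq_of_starCount_eq_zero u v ha]
      exact (ih hq).bracket ω _
    · rw [substStar_eq_of_starCount_eq_zero u v hq, bracket_eq_mul, bracket_eq_mul]
      exact ((iha ha).brac ω).mul_right _

theorem isMonomialOrder_dbLE [LinearOrder X] [LinearOrder Ω] [WellFoundedLT X] [WellFoundedLT Ω] :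
    IsMonomialOrder (DbLE : BracketedWord X Ω → BracketedWord X Ω → Prop) where
  refl _ := .inl rfl
  trans u v w := by
    rintro (rfl | h) (rfl | h')
    · exact .inl rfl
    · exact .inr h'
    · exact .inr h
    · exact .inr (h.trans h')
  antisymm u v := by
    rintro (rfl | h) (h' | h')
    · rfl
    · rfl
    · exact h'.symm
    · exact absurd h' h.asymm
  total u v := by
    rcases dbLT_trichotomous u v with h | h | h
    · exact .inl (.inr h)
    · exact .inl (.inl h)
    · exact .inr (.inr h)
  wf := Subrelation.wf (fun h => strictOf_dbLE_iff.1 h) wellFounded_dbLT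
  plug_lt q _ _ h := strictOf_dbLE_iff.2 ((strictOf_dbLE_iff.1 h).substStar q.2)

/-- Most estimates on leading words below use this criterion, which avoids deciding whether deg_P
drops or stays equal. -/
theorem dbLT_of_breadthP_lt [LinearOrder X] [LinearOrder Ω] {u v : BracketedWord X Ω}
    (h : degP u ≤ degP v) (h' : breadthP u < breadthP v) : DbLT u v := by
  rcases h.lt_or_eq with h | h
  · exact .degP h
  · exact .breadthP h h'

theorem toPoly_mul (k : Type*) [CommRing k] (u v : BracketedWord X Ω) :
    (u * v).toPoly k = u.toPoly k * v.toPoly k := by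
  simp [toPoly, MonoidAlgebra.single_mul_single]

theorem brac_injective {α β : Ω} {u v : BracketedWord X Ω} (h : brac α u = brac β v) :
    α = β ∧ u = v := by
  simpa [brac] using h

theorem brac_mul_injective {α β : Ω} {a b u v : BracketedWord X Ω}
    (h : brac α a * u = brac β b * v) : α = β ∧ a = b ∧ u = v := by
  have : bracket α a u = bracket β b v := h
  simpa using this

end BracketedWord

open BracketedWord

/-! ### ⋆-bracketed words and occurrences of a leading word -/

namespace StarWord

variable {X Ω : Type*}

/-- The word `⋆`. -/
def star : StarWord X Ω := ⟨letter none one, rfl⟩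

/-- The word `⌊q⌋_ω`. -/
def brac (ω : Ω) (q : StarWord X Ω) : StarWord X Ω :=
  ⟨BracketedWord.brac ω q.1, by simp [BracketedWord.brac, starCount, q.2]⟩

/-- The word `u q`. -/
def mulLeft (u : BracketedWord X Ω) (q : StarWord X Ω) : StarWord X Ω :=
  ⟨withStar u * q.1, by simp [q.2]⟩

/-- The word `q u`. -/
def mulRight (q : StarWord X Ω) (u : BracketedWord X Ω) : StarWord X Ω :=
  ⟨q.1 * withStar u, by simp [q.2]⟩

@[simp] theorem plug_star (v : BracketedWord X Ω) : (star : StarWord X Ω).plug v = v :=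
  mul_one v

@[simp] theorem plug_brac (ω : Ω) (q : StarWord X Ω) (v : BracketedWord X Ω) :
    (q.brac ω).plug v = (q.plug v).brac ω := rfl

@[simp] theorem plug_mulLeft (u : BracketedWord X Ω) (q : StarWord X Ω) (v : BracketedWord X Ω) :
    (q.mulLeft u).plug v = u * q.plug v := by
  simp [plug, mulLeft]

@[simp] theorem plug_mulRight (u : BracketedWord X Ω) (q : StarWord X Ω) (v : BracketedWord X Ω) :
    (q.mulRight u).plug v = q.plug v * u := by
  simp [plug, mulRight]

/-- The occurrences of a word of breadth two in a product of two bracketed words. -/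
theorem plug_eq_brac_mul_brac {q : StarWord X Ω} {m x y : BracketedWord X Ω} {α β : Ω}
    (hm : m.breadth = 2) (h : q.plug m = x.brac α * y.brac β) :
    (∀ u, q.plug u = u) ∨
    (∃ p : StarWord X Ω, p.plug m = x ∧ ∀ u, q.plug u = (p.plug u).brac α * y.brac β) ∨
    (∃ p : StarWord X Ω, p.plug m = y ∧ ∀ u, q.plug u = x.brac α * (p.plug u).brac β) := by
  obtain ⟨q, hq⟩ := q
  simp only [plug] at h ⊢
  rcases q with _ | ⟨_ | a, q⟩ | ⟨ω, a, q⟩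
  · simp [starCount] at hq
  · left
    simp only [starCount, Nat.add_eq_right] at hq
    -- The word `m` already uses up the whole breadth 2, so nothing follows ⋆.
    have hb := congrArg breadth h
    simp only [substStar, breadth_mul, breadth_brac, hm] at hb
    have h1 := breadth_eq_zero (u := substStar m q) (by omega)
    intro u
    rw [substStar, substStar_eq_of_starCount_eq_zero u m hq, h1, mul_one]
  · cases h
  · rw [substStar, bracket_eq_mul] at h
    obtain ⟨rfl, h₁, h₂⟩ := brac_mul_injective h
    simp only [starCount, Nat.add_eq_one_iff] at hq
    rcases hq with ⟨ha, hq⟩ | ⟨ha, hq⟩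
    · right; right
      rcases q with _ | ⟨_ | b, q⟩ | ⟨ω', b, q⟩
      · cases h₂
      -- After the first bracket only breadth 1 remains, too little for `m`.
      · have hb := congrArg breadth h₂
        simp [substStar, hm] at hb
        omega
      · cases h₂
      · rw [substStar, bracket_eq_mul, ← mul_one (y.brac β)] at h₂
        obtain ⟨rfl, h₃, h₄⟩ := brac_mul_injective h₂
        -- What follows the second bracket becomes the empty word after substitution, so it cannot
        -- contain ⋆.
        have hq0 : starCount q = 0 := by
          rcases q with _ | ⟨_ | c, q⟩ | ⟨ω'', c, q⟩
          · rfl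
          · have hb := congrArg breadth h₄
            simp [substStar, hm] at hb
          · cases h₄
          · cases h₄
        simp only [starCount, hq0, add_zero] at hq
        refine ⟨⟨b, hq⟩, h₃, fun u => ?_⟩
        rw [substStar, bracket_eq_mul, substStar_eq_of_starCount_eq_zero u m ha, h₁, substStar,
          bracket_eq_mul, substStar_eq_of_starCount_eq_zero u m hq0, h₄, mul_one]
    · right; left
      refine ⟨⟨a, ha⟩, h₁, fun u => ?_⟩
      rw [substStar, bracket_eq_mul, substStar_eq_of_starCount_eq_zero u m hq, h₂]

theorem plugPoly_matchingRelation {k : Type*} [CommRing k] (wt : Ω → k) (q : StarWord X Ω)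
    (α β : Ω) (x y : BracketedWord X Ω) :
    q.plugPoly (matchingRelation wt α β x y) =
      (q.plug (x.brac α * y.brac β)).toPoly k - (q.plug ((x * y.brac β).brac α)).toPoly k
        - (q.plug ((x.brac α * y).brac β)).toPoly k
        - wt β • (q.plug ((x * y).brac α)).toPoly k := by
  have sub (a b : BracketedPoly k X Ω) : q.plugPoly (a - b) = q.plugPoly a - q.plugPoly b := by
    rw [eq_sub_iff_add_eq, plugPoly, plugPoly, ← MonoidAlgebra.mapDomain_add, sub_add_cancel]
    rfl
  have smul (c : k) (a : BracketedPoly k X Ω) : q.plugPoly (c • a) = c • q.plugPoly a :=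
    MonoidAlgebra.mapDomain_smul _ _ _
  have word (u : BracketedWord X Ω) : q.plugPoly (u.toPoly k) = (q.plug u).toPoly k :=
    MonoidAlgebra.mapDomain_single
  simp only [matchingRelation, sub, smul, word]

end StarWord

/-! ### Leading words and triviality of the compositions -/

section Matching

variable {k X Ω : Type*} [CommRing k] [LinearOrder X] [LinearOrder Ω]

theorem dbLT_brac_mul_brac_right (α β : Ω) (x y : BracketedWord X Ω) :
    DbLT ((x * y.brac β).brac α) (x.brac α * y.brac β) :=
  dbLT_of_breadthP_lt (by simp) (by simp)

theorem dbLT_brac_brac_mul_left (α β : Ω) (x y : BracketedWord X Ω) :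
    DbLT ((x.brac α * y).brac β) (x.brac α * y.brac β) :=
  dbLT_of_breadthP_lt (by simp) (by simp)

theorem dbLT_brac_mul (α β : Ω) (x y : BracketedWord X Ω) :
    DbLT ((x * y).brac α) (x.brac α * y.brac β) :=
  dbLT_of_breadthP_lt (by simp; omega) (by simp)

/-- The linear span of the polynomials `q|_s` with `s` a matching Rota-Baxter relation and
`q|_{s̄} < w`. -/
noncomputable def trivialSpan (wt : Ω → k) (w : BracketedWord X Ω) : Submodule k (BracketedPoly k X Ω) :=
  Submodule.span k {h | ∃ (q : StarWord X Ω) (α β : Ω) (x y : BracketedWord X Ω),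
    DbLT (q.plug (x.brac α * y.brac β)) w ∧ q.plugPoly (matchingRelation wt α β x y) = h}

theorem plugPoly_mem_trivialSpan (wt : Ω → k) {w : BracketedWord X Ω} (q : StarWord X Ω)
    (α β : Ω) (x y : BracketedWord X Ω) (h : DbLT (q.plug (x.brac α * y.brac β)) w) :
    q.plugPoly (matchingRelation wt α β x y) ∈ trivialSpan wt w :=
  Submodule.subset_span ⟨q, α, β, x, y, h, rfl⟩

theorem matchingRelation_mem_trivialSpan (wt : Ω → k) {w : BracketedWord X Ω}
    (α β : Ω) (x y : BracketedWord X Ω) (h : DbLT (x.brac α * y.brac β) w) :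
    matchingRelation wt α β x y ∈ trivialSpan wt w := by
  have := plugPoly_mem_trivialSpan wt .star α β x y (by simpa using h)
  simpa [StarWord.plugPoly_matchingRelation, ← matchingRelation.eq_1] using this

/-- The terms record a full reduction of both sides: relations rewrite the products of two brackets,
and the two `plugPoly` terms rewrite the products that then appear inside a bracket. All leading
words have P-breadth at most 2, against 3 for `w`, and no larger deg_P. -/
theorem intersection_mem_trivialSpan (wt : Ω → k) (α β γ : Ω) (x y z : BracketedWord X Ω) :
    matchingRelation wt α β x y * (z.brac γ).toPoly k
      - (x.brac α).toPoly k * matchingRelation wt β γ y z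
      ∈ trivialSpan wt (x.brac α * y.brac β * z.brac γ) := by
  have key : matchingRelation wt α β x y * (z.brac γ).toPoly k
      - (x.brac α).toPoly k * matchingRelation wt β γ y z =
      matchingRelation wt α β x (y * z.brac γ) + matchingRelation wt α γ x (y.brac β * z)
      + wt γ • matchingRelation wt α β x (y * z)
      + ((StarWord.star.mulRight z).brac γ).plugPoly (matchingRelation wt α β x y)
      - matchingRelation wt α γ (x * y.brac β) z - matchingRelation wt β γ (x.brac α * y) z
      - wt β • matchingRelation wt α γ (x * y) z
      - ((StarWord.star.mulLeft x).brac α).plugPoly (matchingRelation wt β γ y z) := by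
    -- Plugged relations are expanded while `matchingRelation` is still folded; unfolding it first
    -- would hide the pattern.
    simp only [StarWord.plugPoly_matchingRelation]
    simp only [matchingRelation, StarWord.plug_brac,
      StarWord.plug_mulLeft, StarWord.plug_mulRight, StarWord.plug_star, sub_mul, mul_sub,
      smul_mul_assoc, mul_smul_comm, ← toPoly_mul, mul_assoc]
    module
  rw [key]
  refine sub_mem (sub_mem (sub_mem (sub_mem (add_mem (add_mem (add_mem ?_ ?_)
    (Submodule.smul_mem _ _ ?_)) ?_) ?_) ?_) (Submodule.smul_mem _ _ ?_)) ?_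
  all_goals
    first
    | apply matchingRelation_mem_trivialSpan
    | apply plugPoly_mem_trivialSpan
    refine dbLT_of_breadthP_lt ?_ (by simp)
    simp
    try omega

/-- Write R(x, y) for the outer relation, extended bilinearly, and g for the inner one. Expand
R(p|_g, y) in two ways: through g, it is R at the leading word of g minus R at its lower words;
through R, it is g plugged into the four words of R. Equating the two isolates the composition. -/
theorem including_left_mem_trivialSpan (wt : Ω → k) (α β γ δ : Ω) (y z t : BracketedWord X Ω)
    (p : StarWord X Ω) :
    matchingRelation wt α β (p.plug (z.brac γ * t.brac δ)) y
      - ((p.brac α).mulRight (y.brac β)).plugPoly (matchingRelation wt γ δ z t)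
      ∈ trivialSpan wt ((p.plug (z.brac γ * t.brac δ)).brac α * y.brac β) := by
  have key : matchingRelation wt α β (p.plug (z.brac γ * t.brac δ)) y
      - ((p.brac α).mulRight (y.brac β)).plugPoly (matchingRelation wt γ δ z t) =
      matchingRelation wt α β (p.plug ((z * t.brac δ).brac γ)) y
      + matchingRelation wt α β (p.plug ((z.brac γ * t).brac δ)) y
      + wt δ • matchingRelation wt α β (p.plug ((z * t).brac γ)) y
      - ((p.mulRight (y.brac β)).brac α).plugPoly (matchingRelation wt γ δ z t)
      - (((p.brac α).mulRight y).brac β).plugPoly (matchingRelation wt γ δ z t)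
      - wt β • ((p.mulRight y).brac α).plugPoly (matchingRelation wt γ δ z t) := by
    simp only [StarWord.plugPoly_matchingRelation]
    simp only [matchingRelation, StarWord.plug_brac,
      StarWord.plug_mulRight]
    module
  -- Here P-breadth stays 2, so the estimate comes from monotonicity of the context around the lower
  -- words of the inner relation.
  have lt {u v : BracketedWord X Ω} (h : DbLT u v) :
      DbLT ((p.plug u).brac α * y.brac β) ((p.plug v).brac α * y.brac β) :=
    ((h.substStar p.2).brac α).mul_right _
  rw [key]
  refine sub_mem (sub_mem (sub_mem (add_mem (add_mem ?_ ?_)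
    (Submodule.smul_mem _ _ ?_)) ?_) ?_) (Submodule.smul_mem _ _ ?_)
  · exact matchingRelation_mem_trivialSpan _ _ _ _ _ (lt (dbLT_brac_mul_brac_right γ δ z t))
  · exact matchingRelation_mem_trivialSpan _ _ _ _ _ (lt (dbLT_brac_brac_mul_left γ δ z t))
  · exact matchingRelation_mem_trivialSpan _ _ _ _ _ (lt (dbLT_brac_mul γ δ z t))
  all_goals
    apply plugPoly_mem_trivialSpan
    refine dbLT_of_breadthP_lt ?_ (by simp)
    simp
    try omega

theorem including_right_mem_trivialSpan (wt : Ω → k) (α β γ δ : Ω) (x z t : BracketedWord X Ω)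
    (p : StarWord X Ω) :
    matchingRelation wt α β x (p.plug (z.brac γ * t.brac δ))
      - ((p.brac β).mulLeft (x.brac α)).plugPoly (matchingRelation wt γ δ z t)
      ∈ trivialSpan wt (x.brac α * (p.plug (z.brac γ * t.brac δ)).brac β) := by
  have key : matchingRelation wt α β x (p.plug (z.brac γ * t.brac δ))
      - ((p.brac β).mulLeft (x.brac α)).plugPoly (matchingRelation wt γ δ z t) =
      matchingRelation wt α β x (p.plug ((z * t.brac δ).brac γ))
      + matchingRelation wt α β x (p.plug ((z.brac γ * t).brac δ))
      + wt δ • matchingRelation wt α β x (p.plug ((z * t).brac γ))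
      - (((p.brac β).mulLeft x).brac α).plugPoly (matchingRelation wt γ δ z t)
      - ((p.mulLeft (x.brac α)).brac β).plugPoly (matchingRelation wt γ δ z t)
      - wt β • ((p.mulLeft x).brac α).plugPoly (matchingRelation wt γ δ z t) := by
    simp only [StarWord.plugPoly_matchingRelation]
    simp only [matchingRelation, StarWord.plug_brac,
      StarWord.plug_mulLeft]
    module
  have lt {u v : BracketedWord X Ω} (h : DbLT u v) :
      DbLT (x.brac α * (p.plug u).brac β) (x.brac α * (p.plug v).brac β) :=
    ((h.substStar p.2).brac β).mul_left _
  rw [key]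
  refine sub_mem (sub_mem (sub_mem (add_mem (add_mem ?_ ?_)
    (Submodule.smul_mem _ _ ?_)) ?_) ?_) (Submodule.smul_mem _ _ ?_)
  · exact matchingRelation_mem_trivialSpan _ _ _ _ _ (lt (dbLT_brac_mul_brac_right γ δ z t))
  · exact matchingRelation_mem_trivialSpan _ _ _ _ _ (lt (dbLT_brac_brac_mul_left γ δ z t))
  · exact matchingRelation_mem_trivialSpan _ _ _ _ _ (lt (dbLT_brac_mul γ δ z t))
  all_goals
    apply plugPoly_mem_trivialSpan
    refine dbLT_of_breadthP_lt ?_ (by simp)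
    simp
    try omega

variable [WellFoundedLT X] [WellFoundedLT Ω]

theorem coeff_matchingRelation_lead (wt : Ω → k) (α β : Ω) (x y : BracketedWord X Ω) :
    (matchingRelation wt α β x y).coeff (x.brac α * y.brac β) = 1 := by
  have h₁ := (dbLT_brac_mul_brac_right α β x y).ne
  have h₂ := (dbLT_brac_brac_mul_left α β x y).ne
  have h₃ := (dbLT_brac_mul α β x y).ne
  simp [matchingRelation, toPoly, h₁, h₂, h₃]

theorem isLeadingWord_matchingRelation [Nontrivial k] (wt : Ω → k) (α β : Ω)
    (x y : BracketedWord X Ω) :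
    IsLeadingWord DbLE (matchingRelation wt α β x y) (x.brac α * y.brac β) := by
  refine ⟨by simp [coeff_matchingRelation_lead], fun u hu => ?_⟩
  by_contra hne
  apply hu
  have h₀ : x.brac α * y.brac β ≠ u := fun h => hne (.inl h.symm)
  have h₁ : (x * y.brac β).brac α ≠ u := fun h =>
    hne (.inr (h ▸ dbLT_brac_mul_brac_right α β x y))
  have h₂ : (x.brac α * y).brac β ≠ u := fun h =>
    hne (.inr (h ▸ dbLT_brac_brac_mul_left α β x y))
  have h₃ : (x * y).brac α ≠ u := fun h => hne (.inr (h ▸ dbLT_brac_mul α β x y))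
  simp [matchingRelation, toPoly, h₀, h₁, h₂, h₃]

theorem IsLeadingWord.unique {f : BracketedPoly k X Ω} {m m' : BracketedWord X Ω}
    (h : IsLeadingWord DbLE f m) (h' : IsLeadingWord DbLE f m') : m = m' :=
  isMonomialOrder_dbLE.antisymm _ _ (h'.2 m h.1) (h.2 m' h'.1)

theorem isMonicPoly_matchingRelation [Nontrivial k] (wt : Ω → k) (α β : Ω)
    (x y : BracketedWord X Ω) : IsMonicPoly DbLE (matchingRelation wt α β x y) := by
  refine ⟨?_, _, isLeadingWord_matchingRelation wt α β x y, coeff_matchingRelation_lead wt α β x y⟩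
  rintro ⟨c, hc⟩
  have h := coeff_matchingRelation_lead wt α β x y
  have hne : (1 : BracketedWord X Ω) ≠ x.brac α * y.brac β := fun h => by
    simpa using congrArg breadth h
  rw [← hc] at h
  simp [MonoidAlgebra.coe_algebraMap, hne] at h

/-- Spans allow free use of sums and scalars. The support of a `Finsupp` representation then
supplies the finite indexing and the nonzero coefficients. -/
theorem isTrivialMod_of_mem_trivialSpan [Nontrivial k] {wt : Ω → k} {w : BracketedWord X Ω}
    {h : BracketedPoly k X Ω} (hh : h ∈ trivialSpan wt w) :
    IsTrivialMod DbLE (matchingRelations X wt) w h := by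
  obtain ⟨c, hc, rfl⟩ := Submodule.mem_span_set.1 hh
  choose q α β x y hlt heq using fun i : c.support => hc i.2
  let e := c.support.equivFin.symm
  refine ⟨c.support.card, fun i => c (e i), fun i => q (e i),
    fun i => matchingRelation wt (α (e i)) (β (e i)) (x (e i)) (y (e i)), fun i => ?_, ?_⟩
  · exact ⟨Finsupp.mem_support_iff.1 (e i).2, ⟨_, _, _, _, rfl⟩, _,
      isLeadingWord_matchingRelation _ _ _ _ _, strictOf_dbLE_iff.2 (hlt (e i))⟩
  · simp only [heq]
    rw [e.sum_comp (fun j => c j • (j : BracketedPoly k X Ω)), Finsupp.sum,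
      Finset.sum_coe_sort c.support (fun j => c j • j)]

end Matching

theorem BracketedWord.overlap_of_breadth_eq_three {X Ω : Type*} {α β γ δ : Ω}
    {x y z t u v : BracketedWord X Ω}
    (h : x.brac α * y.brac β * u = v * (z.brac γ * t.brac δ))
    (hv : v.breadth = 1) : v = x.brac α ∧ z = y ∧ γ = β ∧ u = t.brac δ := by
  rw [mul_assoc] at h
  rcases v with _ | ⟨a, v⟩ | ⟨ω, a, v⟩
  · simp at hv
  · cases h
  · have hv' : v = 1 := breadth_eq_zero (by simpa [breadth] using hv)
    subst hv'
    rw [bracket_eq_mul, mul_one] at h ⊢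
    obtain ⟨rfl, rfl, h'⟩ := brac_mul_injective h
    obtain ⟨rfl, rfl, rfl⟩ := brac_mul_injective h'
    exact ⟨rfl, rfl, rfl, rfl⟩

theorem mainTheorem5 {k X Ω : Type*} [CommRing k] [Nontrivial k]
    [LinearOrder X] [WellFoundedLT X] [LinearOrder Ω] [WellFoundedLT Ω] [Nonempty Ω]
    (wt : Ω → k) :
    IsGroebnerShirshovBasis (BracketedWord.DbLE (X := X) (Ω := Ω)) (matchingRelations X wt) := by
  refine ⟨isMonomialOrder_dbLE, ?_, ?_, ?_⟩
  · rintro _ ⟨α, β, x, y, rfl⟩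
    exact isMonicPoly_matchingRelation wt α β x y
  · rintro _ ⟨α, β, x, y, rfl⟩ _ ⟨γ, δ, z, t, rfl⟩ mf mg hf hg u v w hw hw' hlt hlt'
    obtain rfl := hf.unique (isLeadingWord_matchingRelation wt α β x y)
    obtain rfl := hg.unique (isLeadingWord_matchingRelation wt γ δ z t)
    subst hw
    -- Both leading words have breadth 2, so `w` has breadth strictly between 2 and 4.
    have hv : v.breadth = 1 := by
      rw [hw'] at hlt hlt'
      simp at hlt hlt'
      omega
    obtain ⟨rfl, rfl, rfl, rfl⟩ := overlap_of_breadth_eq_three hw' hv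
    exact isTrivialMod_of_mem_trivialSpan (intersection_mem_trivialSpan wt _ _ _ _ _ _)
  · rintro _ ⟨α, β, x, y, rfl⟩ _ ⟨γ, δ, z, t, rfl⟩ mf mg hf hg q w hw hw'
    obtain rfl := hf.unique (isLeadingWord_matchingRelation wt α β x y)
    obtain rfl := hg.unique (isLeadingWord_matchingRelation wt γ δ z t)
    subst hw
    apply isTrivialMod_of_mem_trivialSpan
    rcases StarWord.plug_eq_brac_mul_brac (by simp) hw'.symm with
      hq | ⟨p, rfl, hq⟩ | ⟨p, rfl, hq⟩
    · rw [hq] at hw'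
      obtain ⟨rfl, rfl, h⟩ := brac_mul_injective hw'
      obtain ⟨rfl, rfl⟩ := brac_injective h
      rw [StarWord.plugPoly_matchingRelation]
      simp only [hq]
      rw [matchingRelation, sub_self]
      exact zero_mem _
    -- `plugPoly` sees a ⋆-word only through its substitution function, so equality of these
    -- functions suffices.
    · have : q.plug = ((p.brac α).mulRight (y.brac β)).plug := by
        funext u
        simp [hq]
      rw [StarWord.plugPoly, this]
      exact including_left_mem_trivialSpan wt α β γ δ y z t p
    · have : q.plug = ((p.brac β).mulLeft (x.brac α)).plug := by
        funext u
        simp [hq]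
      rw [StarWord.plugPoly, this]
      exact including_right_mem_trivialSpan wt α β γ δ x z t p
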